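/- Let $G$ be a finite simple graph that is cubic (every vertex has degree $3$) and $2$-connected (more than two vertices, connected, and still connected after the deletion of any one vertex). An incidence of $G$ is a pair $(u,e)$ of a vertex $u$ and an edge $e$ with $u$ an endpoint of $e$; two distinct incidences $(u,e)$ and $(v,f)$ are adjacent if $u=v$, or $e=f$, or $uv=e$, or $uv=f$. For $k\ge 0$, the graph $G$ is incidence $k$-choosable if, whenever each incidence $(u,e)$ is assigned a list $L(u,e)$ of exactly $k$ colors, there is a function $\varphi$ on the incidences with $\varphi(u,e)\in L(u,e)$ for every incidence $(u,e)$ and $\varphi(u,e)\ne\varphi(v,f)$ for any two adjacent incidences $(u,e)$ and $(v,f)$. The incidence choice number $ch_i(G)$ is the smallest integer $k\ge 0$ such that $G$ is incidence $k$-choosable. Then \[ch_i(G)\le 6.\] -/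

import Mathlib

universe u w

namespace SimpleGraph

/-- An incidence of `G`: a pair `(u, e)` of a vertex `u` and an edge `e` of `G` such that `u` is an
endpoint of `e`. -/
abbrev Incidence {V : Type u} (G : SimpleGraph V) : Type u :=
  {p : V × Sym2 V // p.2 ∈ G.edgeSet ∧ p.1 ∈ p.2}

/-- Two (distinct) incidences `(u, e)` and `(v, f)` are adjacent if `u = v`, or `e = f`, or `uv = e`
or `uv = f`. -/
def IncidenceAdj {V : Type u} (G : SimpleGraph V) (i j : G.Incidence) : Prop :=
  i ≠ j ∧
    (i.1.1 = j.1.1 ∨ i.1.2 = j.1.2 ∨ s(i.1.1, j.1.1) = i.1.2 ∨ s(i.1.1, j.1.1) = j.1.2)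

/-- An incidence coloring: adjacent incidences receive different colors. -/
def IsIncidenceColoring {V : Type u} (G : SimpleGraph V) {α : Type w}
    (φ : G.Incidence → α) : Prop :=
  ∀ i j : G.Incidence, G.IncidenceAdj i j → φ i ≠ φ j

/-- `G` is incidence `L`-choosable: it has an incidence coloring that takes the color of every
incidence from the list of that incidence. -/
def IncidenceListChoosable {V : Type u} (G : SimpleGraph V) {α : Type w}
    (L : G.Incidence → Finset α) : Prop :=
  ∃ φ : G.Incidence → α, G.IsIncidenceColoring φ ∧ ∀ i, φ i ∈ L i

/-- `G` is incidence `k`-choosable: it is incidence `L`-choosable for every assignment `L` of lists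
with exactly `k` colors each, the colors being taken from an arbitrary type. -/
def IncidenceChoosable {V : Type u} (G : SimpleGraph V) (k : ℕ) : Prop :=
  ∀ (α : Type w) (L : G.Incidence → Finset α), (∀ i, (L i).card = k) → G.IncidenceListChoosable L

/-- The incidence choice number: the smallest `k` such that `G` is incidence `k`-choosable
(`⊤` if there is no such `k`). -/
noncomputable def incidenceChoiceNumber {V : Type u} (G : SimpleGraph V) : ℕ∞ :=
  ⨅ k : ℕ, ⨅ _ : IncidenceChoosable.{u, w} G k, (k : ℕ∞)

/-- `G` is 2-connected: it has more than two vertices, it is connected, and it stays connected when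
any single vertex is deleted. -/
def IsTwoConnected {V : Type u} (G : SimpleGraph V) : Prop :=
  2 < ENat.card V ∧ G.Connected ∧ ∀ v : V, (G.induce {v}ᶜ).Connected

end SimpleGraph

/-! An incidence `(u, uv)` is the dart from `u` to `v`. Two darts conflict exactly when they share a
tail or one starts where the other ends, so the task is a list coloring of darts from lists of size
6.

The darts leaving a vertex with an uncolored neighbor can always be colored greedily
(`exists_insert`), so by connectedness everything outside an induced cycle `S` is colored towards
`S` (`exists_extension`). Take `x` on `S` with cycle neighbors `t`, `u` and outer neighbor `r`.
After fixing colors `a` on `xu` and `m` on `xr`, color the rest of the cycle towards `t`. What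
remains are the three darts leaving `t`; the two cycle darts entering `t` are freed again. These
five darts form `K₅` minus an edge, and `exists_completion` colors them when the remaining lists of
`tv` and `tx`, with `v` the outer neighbor of `t`, have a union of size at least 4, and either this
union has size at least 5 or `xt` keeps 3 colors.

`exists_four_le_card_union` secures the 4. The extra color is gained if some dart at `x` or `t` can
take a color useless to another one. Otherwise the available lists are nested in a common 5-set, so
two 3-sets in it meet, and choosing `a` and `m` inside the list of `tv` makes the union large. -/

namespace SimpleGraph

open Finset

/-! ### Distinct representatives and list colorings of small graphs -/

section SystemsOfRepresentatives

variable {α : Type w} [DecidableEq α]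

/-- Greedy choice of three distinct representatives. -/
theorem exists_distinct_of_card {A B D : Finset α} (hA : 1 ≤ #A) (hB : 2 ≤ #B) (hD : 3 ≤ #D) :
    ∃ a ∈ A, ∃ b ∈ B, ∃ d ∈ D, a ≠ b ∧ a ≠ d ∧ b ≠ d := by
  obtain ⟨a, ha⟩ := Finset.card_pos.1 hA
  obtain ⟨b, hb, hb'⟩ := Finset.exists_mem_notMem_of_card_lt_card (s := {a}) (t := B)
    (by rw [card_singleton]; omega)
  obtain ⟨d, hd, hd'⟩ := Finset.exists_mem_notMem_of_card_lt_card (s := {a, b}) (t := D)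
    (lt_of_le_of_lt card_le_two (by omega))
  simp only [mem_singleton, mem_insert, not_or] at hb' hd'
  exact ⟨a, ha, b, hb, d, hd, Ne.symm hb', Ne.symm hd'.1, Ne.symm hd'.2⟩

/-- If `#X = 2`, some `y ∈ Y` lies outside `X`; it cannot clash with `x`, so `z` and then `x` are
chosen greedily. -/
theorem exists_distinct_of_card_union {X Y Z : Finset α} (hX : 2 ≤ #X) (hY : 2 ≤ #Y) (hZ : 2 ≤ #Z)
    (hXY : 3 ≤ #(X ∪ Y)) : ∃ x ∈ X, ∃ y ∈ Y, ∃ z ∈ Z, x ≠ y ∧ x ≠ z ∧ y ≠ z := by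
  by_cases hX3 : 3 ≤ #X
  · obtain ⟨y, hy, z, hz, x, hx, h1, h2, h3⟩ := exists_distinct_of_card (A := Y) (by omega) hZ hX3
    exact ⟨x, hx, y, hy, z, hz, h2.symm, h3.symm, h1⟩
  · obtain ⟨y, hy, hyX⟩ := Finset.exists_mem_notMem_of_card_lt_card (s := X) (t := X ∪ Y) (by omega)
    have hyY : y ∈ Y := by simpa [hyX] using hy
    obtain ⟨z, hz, hzy⟩ := Finset.exists_mem_notMem_of_card_lt_card (s := {y}) (t := Z)
      (by rw [card_singleton]; omega)
    obtain ⟨x, hx, hxz⟩ := Finset.exists_mem_notMem_of_card_lt_card (s := {z}) (t := X)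
      (by rw [card_singleton]; omega)
    rw [mem_singleton] at hzy hxz
    exact ⟨x, hx, y, hyY, z, hz, fun h => hyX (h ▸ hx), hxz, Ne.symm hzy⟩

/-- A list coloring of `K₅` minus an edge; the nonadjacent vertices have the lists `A` and `B`. -/
theorem exists_coloring_completeGraph_five_minus_edge {A B F₁ F₂ F₃ : Finset α}
    (hA : 2 ≤ #A) (hB : 2 ≤ #B) (h₁ : 3 ≤ #F₁) (h₂ : 3 ≤ #F₂) (h₃ : 3 ≤ #F₃)
    (h₁₂ : 4 ≤ #(F₁ ∪ F₂)) (h : 3 ≤ #B ∨ 5 ≤ #(F₁ ∪ F₂)) :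
    ∃ a ∈ A, ∃ b ∈ B, ∃ f₁ ∈ F₁, ∃ f₂ ∈ F₂, ∃ f₃ ∈ F₃, (f₁ ≠ f₂ ∧ f₁ ≠ f₃ ∧ f₂ ≠ f₃) ∧
      (a ≠ f₁ ∧ a ≠ f₂ ∧ a ≠ f₃) ∧ (b ≠ f₁ ∧ b ≠ f₂ ∧ b ≠ f₃) := by
  -- For disjoint `A`, `B` Hall's condition holds: four or more sets include both `A`, `B` or both
  -- `F₁`, `F₂`. Otherwise a common color serves both nonadjacent vertices, leaving a triangle.
  by_cases hAB : Disjoint A B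
  · let F : Fin 5 → Finset α := ![A, B, F₁, F₂, F₃]
    have hU : 4 ≤ #(A ∪ B) := by rw [card_union_of_disjoint hAB]; omega
    have hall : ∀ s : Finset (Fin 5), #s ≤ #(s.biUnion F) := by
      intro s
      have hsub : ∀ i ∈ s, F i ⊆ s.biUnion F := fun i hi => subset_biUnion_of_mem F hi
      have hsub2 : ∀ i ∈ s, ∀ j ∈ s, #(F i ∪ F j) ≤ #(s.biUnion F) := fun i hi j hj =>
        card_le_card (union_subset (hsub i hi) (hsub j hj))
      have hsub1 : ∀ i ∈ s, #(F i) ≤ #(s.biUnion F) := fun i hi => card_le_card (hsub i hi)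
      have hcard : #s = ∑ i : Fin 5, if i ∈ s then 1 else 0 := by simp
      have e1 := hsub1 1
      have e0 := hsub1 0
      have e2 := hsub1 2
      have e3 := hsub1 3
      have e4 := hsub1 4
      have e01 := fun h => hsub2 0 h 1
      have e23 := fun h => hsub2 2 h 3
      have hU5 : 3 ≤ #B → 5 ≤ #(A ∪ B) := by rw [card_union_of_disjoint hAB]; omega
      generalize #(s.biUnion F) = n at *
      simp only [F, Matrix.cons_val] at e0 e1 e2 e3 e4 e01 e23
      rw [hcard, Fin.sum_univ_five]
      by_cases i0 : 0 ∈ s <;> by_cases i1 : 1 ∈ s <;> by_cases i2 : 2 ∈ s <;>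
        by_cases i3 : 3 ∈ s <;> by_cases i4 : 4 ∈ s <;>
        simp only [i0, i1, i2, i3, i4, if_true, if_false, forall_true_left, false_implies]
          at e0 e1 e2 e3 e4 e01 e23 ⊢ <;>
        omega
    obtain ⟨f, hinj, hf⟩ := (Finset.all_card_le_biUnion_card_iff_exists_injective F).1 hall
    have hne : ∀ i j : Fin 5, i ≠ j → f i ≠ f j := fun i j hij h => hij (hinj h)
    exact ⟨f 0, hf 0, f 1, hf 1, f 2, hf 2, f 3, hf 3, f 4, hf 4,
      ⟨hne _ _ (by decide), hne _ _ (by decide), hne _ _ (by decide)⟩,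
      ⟨hne _ _ (by decide), hne _ _ (by decide), hne _ _ (by decide)⟩,
      ⟨hne _ _ (by decide), hne _ _ (by decide), hne _ _ (by decide)⟩⟩
  · obtain ⟨e, heA, heB⟩ := Finset.not_disjoint_iff.1 hAB
    have c₁ := pred_card_le_card_erase (s := F₁) (a := e)
    have c₂ := pred_card_le_card_erase (s := F₂) (a := e)
    have c₃ := pred_card_le_card_erase (s := F₃) (a := e)
    have c₁₂ := pred_card_le_card_erase (s := F₁ ∪ F₂) (a := e)
    rw [erase_union_distrib] at c₁₂
    obtain ⟨f₁, hf₁, f₂, hf₂, f₃, hf₃, hne⟩ := exists_distinct_of_card_union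
      (X := F₁.erase e) (Y := F₂.erase e) (Z := F₃.erase e)
      (by omega) (by omega) (by omega) (by omega)
    rw [mem_erase] at hf₁ hf₂ hf₃
    exact ⟨e, heA, e, heB, f₁, hf₁.2, f₂, hf₂.2, f₃, hf₃.2, hne,
      ⟨hf₁.1.symm, hf₂.1.symm, hf₃.1.symm⟩, ⟨hf₁.1.symm, hf₂.1.symm, hf₃.1.symm⟩⟩

/-- If `#R ≥ 2`, then some `a ∈ R` can be removed from `X.erase m` such that `F` and the remaining
set do not coincide in a set of size three. -/
theorem exists_four_le_card_union {R X F : Finset α} {m : α} (hR : 2 ≤ #R) (hX : 5 ≤ #X)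
    (hF : 3 ≤ #F) : ∃ a ∈ R, 4 ≤ #(F ∪ (X \ {a, m})) := by
  -- If every `a` fails, then `X \ {a, m} = F` has size three and `a ∈ X`; two different `a` cannot
  -- leave the same set.
  by_contra! hcon
  have key : ∀ a ∈ R, a ∈ X ∧ X \ {a, m} = F := by
    intro a ha
    have h1 := hcon a ha
    have h2 : 5 ≤ #(X \ {a, m}) + #({a, m} : Finset α) := hX.trans (by
      have := le_card_sdiff {a, m} X
      omega)
    have h3 : #({a, m} : Finset α) ≤ 2 := card_le_two
    have hF' : F = F ∪ (X \ {a, m}) := eq_of_subset_of_card_le subset_union_left (by omega)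
    have hX' : X \ {a, m} = F ∪ (X \ {a, m}) :=
      eq_of_subset_of_card_le subset_union_right (by omega)
    refine ⟨?_, hX'.trans hF'.symm⟩
    by_contra haX
    have : X \ {a, m} = X.erase m := by
      ext z
      simp only [mem_sdiff, mem_insert, mem_singleton, mem_erase]
      constructor
      · tauto
      · rintro ⟨hz, hzX⟩
        exact ⟨hzX, by rintro (rfl | rfl) <;> contradiction⟩
    rw [this] at hX' h1
    have := pred_card_le_card_erase (s := X) (a := m)
    rw [← hX'] at h1
    omega
  obtain ⟨a, ha⟩ := Finset.card_pos.1 (show 0 < #R by omega)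
  obtain ⟨b, hb, hba⟩ := Finset.exists_mem_notMem_of_card_lt_card (s := {a}) (t := R)
    (by rw [card_singleton]; omega)
  rw [mem_singleton] at hba
  have hab : X \ {a, m} = X \ {b, m} := (key a ha).2.trans (key b hb).2.symm
  have h1 : b ∉ X \ {b, m} := by simp
  rw [← hab] at h1
  have hbm : b = m := by
    by_contra hbm
    exact h1 (by simp [(key b hb).1, hba, hbm])
  have h2 : a ∉ X \ {a, m} := by simp
  rw [hab] at h2
  have ham : a = m := by
    by_contra ham
    exact h2 (by simp [(key a ha).1, Ne.symm hba, ham])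
  exact hba (hbm.trans ham.symm)

theorem le_card_sdiff_of_card_le {A B : Finset α} {m n : ℕ} (hB : #B ≤ m) (hA : m + n ≤ #A) :
    n ≤ #(A \ B) := by
  have := le_card_sdiff B A
  omega

end SystemsOfRepresentatives

/-! ### Existence of an induced cycle -/

section InducedCycle

variable {V : Type u} [Fintype V] [DecidableEq V] (G : SimpleGraph V) [DecidableRel G.Adj]

/-- The set `S` induces a cycle: all its induced degrees are `2`, and at least two edges
leave every nonempty proper subset. -/
structure IsInducedCycle (S : Finset V) : Prop where
  nonempty : S.Nonempty
  card_inter : ∀ s ∈ S, #(G.neighborFinset s ∩ S) = 2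
  two_le_cut : ∀ K ⊆ S, K.Nonempty → K ≠ S → 2 ≤ ∑ k ∈ K, #(G.neighborFinset k ∩ (S \ K))

theorem sum_card_neighborFinset_inter_of_mem {Y : Finset V} {v : V} (hv : v ∈ Y) :
    ∑ y ∈ Y, #(G.neighborFinset y ∩ Y) =
      ∑ y ∈ Y.erase v, #(G.neighborFinset y ∩ Y.erase v) + 2 * #(G.neighborFinset v ∩ Y) := by
  have h1 : ∀ y ∈ Y.erase v, #(G.neighborFinset y ∩ Y) =
      #(G.neighborFinset y ∩ Y.erase v) + if G.Adj v y then 1 else 0 := by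
    intro y hy
    rw [inter_erase]
    split_ifs with h
    · have : v ∈ G.neighborFinset y ∩ Y := by simp [hv, h.symm]
      rw [card_erase_add_one this]
    · rw [erase_eq_of_notMem]
      · rfl
      · simp [G.adj_comm y v, h]
  have h2 : ∑ y ∈ Y.erase v, (if G.Adj v y then 1 else 0) = #(G.neighborFinset v ∩ Y) := by
    rw [← card_filter]
    congr 1
    ext z
    simp only [mem_filter, mem_erase, mem_inter, mem_neighborFinset]
    constructor
    · tauto
    · rintro ⟨h, hz⟩
      exact ⟨⟨h.ne', hz⟩, h⟩
  rw [← add_sum_erase Y _ hv, sum_congr rfl h1, sum_add_distrib, h2]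
  ring

/-- The forest bound on edges: peeling off a vertex of degree at most 1 lowers the degree sum by at
most 2, and the last vertex has degree 0. -/
theorem sum_card_neighborFinset_inter_add_two_le {Y : Finset V} (hY : Y.Nonempty)
    (h : ∀ Z ⊆ Y, Z.Nonempty → ∃ v ∈ Z, #(G.neighborFinset v ∩ Z) ≤ 1) :
    ∑ y ∈ Y, #(G.neighborFinset y ∩ Y) + 2 ≤ 2 * #Y := by
  induction hn : #Y generalizing Y with
  | zero => exact absurd hn hY.card_pos.ne'
  | succ n ih =>
    obtain ⟨v, hv, hdeg⟩ := h Y subset_rfl hY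
    rw [sum_card_neighborFinset_inter_of_mem G hv]
    have hc : #(Y.erase v) = n := by rw [card_erase_of_mem hv, hn]; rfl
    rcases (Y.erase v).eq_empty_or_nonempty with he | hne
    · have : #(G.neighborFinset v ∩ Y) = 0 := by
        rw [card_eq_zero, eq_empty_iff_forall_notMem]
        intro z hz
        rw [mem_inter, mem_neighborFinset] at hz
        have : z ∈ Y.erase v := mem_erase.2 ⟨hz.1.ne', hz.2⟩
        simp [he] at this
      rw [he, this, sum_empty]
      omega
    · have := ih hne (fun Z hZ => h Z (hZ.trans (erase_subset _ _))) hc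
      omega

/-- A cubic graph has an induced cycle. -/
theorem IsRegularOfDegree.exists_isInducedCycle [Nonempty V] (hG : G.IsRegularOfDegree 3) :
    ∃ S : Finset V, G.IsInducedCycle S := by
  let p : Finset V → Prop := fun S => S.Nonempty ∧ ∀ s ∈ S, 2 ≤ #(G.neighborFinset s ∩ S)
  have hp : p univ := ⟨univ_nonempty, fun s _ => by
    rw [inter_univ, card_neighborFinset_eq_degree, hG s]; omega⟩
  -- A minimal set of minimum induced degree at least 2: its nonempty proper subsets obey the forest
  -- bound.
  obtain ⟨S, -, hS⟩ := Finite.exists_le_minimal hp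
  obtain ⟨⟨hne, hdeg⟩, hmin⟩ := hS
  have hproper : ∀ K ⊆ S, K.Nonempty → K ≠ S →
      ∑ k ∈ K, #(G.neighborFinset k ∩ K) + 2 ≤ 2 * #K := by
    intro K hK hKne hKS
    refine G.sum_card_neighborFinset_inter_add_two_le hKne fun Z hZ hZne => ?_
    by_contra! hcon
    have := hmin (y := Z) ⟨hZne, fun s hs => hcon s hs⟩ (hZ.trans hK)
    exact hKS (subset_antisymm hK (this.trans hZ))
  have hdeg3 : ∀ s, #(G.neighborFinset s ∩ S) ≤ 3 := fun s => by
    rw [← hG s, ← card_neighborFinset_eq_degree]; exact card_le_card inter_subset_left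
  have hupper : ∀ s ∈ S, ∑ y ∈ S, #(G.neighborFinset y ∩ S) + 4 ≤
      2 * #S + 2 * #(G.neighborFinset s ∩ S) := by
    intro s hs
    have hcard := card_erase_add_one hs
    have hne' : (S.erase s).Nonempty := by
      obtain ⟨z, hz⟩ := Finset.card_pos.1 (show 0 < #(G.neighborFinset s ∩ S) by
        have := hdeg s hs; omega)
      rw [mem_inter, mem_neighborFinset] at hz
      exact ⟨z, mem_erase.2 ⟨hz.1.ne', hz.2⟩⟩
    have h1 := hproper (S.erase s) (erase_subset _ _) hne' (by
      intro h; rw [h] at hcard; omega)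
    rw [sum_card_neighborFinset_inter_of_mem G hs]
    omega
  -- If all degrees were 3, `hupper` would force `#S ≤ 2`. With one vertex of degree 2, `hupper`
  -- bounds the degree sum by `2 * #S`, so all degrees are 2.
  have hex : ∃ s ∈ S, #(G.neighborFinset s ∩ S) = 2 := by
    by_contra! hcon
    have h3 : ∀ s ∈ S, #(G.neighborFinset s ∩ S) = 3 := fun s hs => by
      have := hdeg s hs; have := hcon s hs; have := hdeg3 s; omega
    obtain ⟨s, hs⟩ := hne
    have h1 := hupper s hs
    rw [sum_congr rfl h3, h3 s hs, sum_const, smul_eq_mul] at h1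
    have h2 : #(G.neighborFinset s ∩ S) ≤ #S := card_le_card inter_subset_right
    rw [h3 s hs] at h2
    omega
  have htwo : ∀ s ∈ S, #(G.neighborFinset s ∩ S) = 2 := by
    obtain ⟨s₀, hs₀, h₀⟩ := hex
    have h1 := hupper s₀ hs₀
    intro s hs
    have h2 : ∑ y ∈ S.erase s, 2 ≤ ∑ y ∈ S.erase s, #(G.neighborFinset y ∩ S) :=
      sum_le_sum fun y hy => hdeg y (mem_of_mem_erase hy)
    rw [← add_sum_erase S _ hs] at h1
    rw [sum_const, smul_eq_mul] at h2
    have h3 := card_erase_add_one hs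
    have h4 := hdeg s hs
    omega
  refine ⟨S, hne, htwo, fun K hK hKne hKS => ?_⟩
  have h1 := hproper K hK hKne hKS
  have h2 : ∑ k ∈ K, #(G.neighborFinset k ∩ S) = ∑ k ∈ K, #(G.neighborFinset k ∩ K) +
      ∑ k ∈ K, #(G.neighborFinset k ∩ (S \ K)) := by
    rw [← sum_add_distrib]
    refine sum_congr rfl fun k _ => ?_
    rw [← card_union_of_disjoint, ← inter_union_distrib_left, union_sdiff_of_subset hK]
    exact (disjoint_sdiff.mono inter_subset_right inter_subset_right)
  rw [sum_congr rfl fun k hk => htwo k (hK hk), sum_const, smul_eq_mul] at h2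
  omega

end InducedCycle

/-! ### Partial dart colorings: greedy extension and completion at the last vertex -/

section DartColoring

variable {V : Type u} {α : Type w} {G : SimpleGraph V}

/-- `s` has exactly the three neighbors `a`, `b` and `d`. -/
structure IsNeighborTriple (G : SimpleGraph V) (s a b d : V) : Prop where
  adj_iff : ∀ z, G.Adj s z ↔ z = a ∨ z = b ∨ z = d
  ne₁₂ : a ≠ b
  ne₁₃ : a ≠ d
  ne₂₃ : b ≠ d

namespace IsNeighborTriple

variable {s a b d : V}

theorem adj₁ (h : G.IsNeighborTriple s a b d) : G.Adj s a := (h.adj_iff a).2 (by simp)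
theorem adj₂ (h : G.IsNeighborTriple s a b d) : G.Adj s b := (h.adj_iff b).2 (by simp)
theorem adj₃ (h : G.IsNeighborTriple s a b d) : G.Adj s d := (h.adj_iff d).2 (by simp)

theorem swap (h : G.IsNeighborTriple s a b d) : G.IsNeighborTriple s b a d :=
  ⟨fun z => by rw [h.adj_iff]; tauto, h.ne₁₂.symm, h.ne₂₃, h.ne₁₃⟩

theorem rotate (h : G.IsNeighborTriple s a b d) : G.IsNeighborTriple s b d a :=
  ⟨fun z => by rw [h.adj_iff]; tauto, h.ne₂₃, h.ne₁₂.symm, h.ne₁₃.symm⟩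

end IsNeighborTriple

/-- A coloring `c u v` of the darts `(u, v)` with `u ∈ W` from the lists `L u v`: darts with the same
tail and consecutive darts get different colors. -/
structure IsDartColoringOn (G : SimpleGraph V) (L : V → V → Finset α) (W : Finset V)
    (c : V → V → α) : Prop where
  mem : ∀ u ∈ W, ∀ v, G.Adj u v → c u v ∈ L u v
  tail : ∀ u ∈ W, ∀ v w, G.Adj u v → G.Adj u w → v ≠ w → c u v ≠ c u w
  head : ∀ u ∈ W, ∀ v ∈ W, ∀ w, G.Adj u v → G.Adj v w → c u v ≠ c v w

section OutColors

variable [Fintype V] [DecidableRel G.Adj] [DecidableEq α]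

/-- The colors of the darts that leave `s`. -/
def outColors (G : SimpleGraph V) [DecidableRel G.Adj] (c : V → V → α) (s : V) : Finset α :=
  (G.neighborFinset s).image (c s)

theorem mem_outColors {c : V → V → α} {s z : V} (h : G.Adj s z) : c s z ∈ G.outColors c s :=
  mem_image_of_mem _ (by simpa using h)

theorem IsRegularOfDegree.card_outColors_le (hG : G.IsRegularOfDegree 3) (c : V → V → α) (s : V) :
    #(G.outColors c s) ≤ 3 :=
  card_image_le.trans (by rw [card_neighborFinset_eq_degree, hG s])

end OutColors

variable [DecidableEq V] {L : V → V → Finset α} {W : Finset V} {c : V → V → α}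

namespace IsDartColoringOn

/-- Color the darts that leave a new vertex. -/
theorem extend (h : G.IsDartColoringOn L W c) {s p q r : V} (hs : s ∉ W)
    (hn : G.IsNeighborTriple s p q r) {e₁ e₂ e₃ : α}
    (h₁ : e₁ ∈ L s p) (h₂ : e₂ ∈ L s q) (h₃ : e₃ ∈ L s r)
    (h₁₂ : e₁ ≠ e₂) (h₁₃ : e₁ ≠ e₃) (h₂₃ : e₂ ≠ e₃)
    (hin : ∀ z ∈ W, G.Adj s z → c z s ≠ e₁ ∧ c z s ≠ e₂ ∧ c z s ≠ e₃)
    (hp : p ∈ W → ∀ z, G.Adj p z → e₁ ≠ c p z) (hq : q ∈ W → ∀ z, G.Adj q z → e₂ ≠ c q z)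
    (hr : r ∈ W → ∀ z, G.Adj r z → e₃ ≠ c r z) :
    ∃ c', G.IsDartColoringOn L (insert s W) c' ∧ (∀ u, u ≠ s → c' u = c u) ∧
      c' s p = e₁ ∧ c' s q = e₂ ∧ c' s r = e₃ := by
  obtain ⟨g, hg₁, hg₂, hg₃⟩ : ∃ g : V → α, g p = e₁ ∧ g q = e₂ ∧ g r = e₃ :=
    ⟨fun v => if v = p then e₁ else if v = q then e₂ else e₃, by simp,
      by simp [hn.ne₁₂.symm], by simp [hn.ne₁₃.symm, hn.ne₂₃.symm]⟩
  have hWs : ∀ u ∈ W, u ≠ s := fun u hu hus => hs (hus ▸ hu)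
  have hss : ¬ G.Adj s s := G.irrefl
  refine ⟨Function.update c s g, ⟨?_, ?_, ?_⟩, fun u hu => Function.update_of_ne hu _ _,
    by simpa using hg₁, by simpa using hg₂, by simpa using hg₃⟩
  · intro u hu v huv
    rcases mem_insert.1 hu with rfl | hu
    · rw [Function.update_self]
      rcases (hn.adj_iff v).1 huv with rfl | rfl | rfl <;> simp [*]
    · rw [Function.update_of_ne (hWs u hu)]
      exact h.mem u hu v huv
  · intro u hu v w huv huw hvw
    rcases mem_insert.1 hu with rfl | hu
    · rw [Function.update_self]
      rcases (hn.adj_iff v).1 huv with rfl | rfl | rfl <;>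
        rcases (hn.adj_iff w).1 huw with rfl | rfl | rfl <;>
        simp_all [Ne.symm h₁₂, Ne.symm h₁₃, Ne.symm h₂₃]
    · rw [Function.update_of_ne (hWs u hu)]
      exact h.tail u hu v w huv huw hvw
  · intro u hu v hv w huv hvw
    rcases mem_insert.1 hu with rfl | hu' <;> rcases mem_insert.1 hv with rfl | hv'
    · exact absurd huv hss
    · rw [Function.update_self, Function.update_of_ne (hWs v hv')]
      rcases (hn.adj_iff v).1 huv with rfl | rfl | rfl
      · rw [hg₁]; exact hp hv' w hvw
      · rw [hg₂]; exact hq hv' w hvw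
      · rw [hg₃]; exact hr hv' w hvw
    · rw [Function.update_self, Function.update_of_ne (hWs u hu')]
      obtain ⟨i₁, i₂, i₃⟩ := hin u hu' huv.symm
      rcases (hn.adj_iff w).1 hvw with rfl | rfl | rfl
      · rwa [hg₁]
      · rwa [hg₂]
      · rwa [hg₃]
    · rw [Function.update_of_ne (hWs u hu'), Function.update_of_ne (hWs v hv')]
      exact h.head u hu' v hv' w huv hvw

/-- Recolor a dart whose head is not in `W`. -/
theorem recolor (h : G.IsDartColoringOn L W c) {s p q t : V} (ht : t ∉ W)
    (hn : G.IsNeighborTriple s p q t) {e : α} (he : e ∈ L s t) (hp : e ≠ c s p) (hq : e ≠ c s q)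
    (hp' : e ≠ c p s) (hq' : e ≠ c q s) :
    G.IsDartColoringOn L W (Function.update c s (Function.update (c s) t e)) := by
  have hWt : ∀ u ∈ W, u ≠ t := fun u hu hut => ht (hut ▸ hu)
  have hne : ∀ u v, (u ≠ s ∨ v ≠ t) →
      Function.update c s (Function.update (c s) t e) u v = c u v := by
    intro u v huv
    by_cases hu : u = s
    · subst hu
      rw [Function.update_self, Function.update_of_ne (by tauto)]
    · rw [Function.update_of_ne hu]
  have hst : Function.update c s (Function.update (c s) t e) s t = e := by simp
  have hother : ∀ v, G.Adj s v → v ≠ t → e ≠ c s v := by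
    intro v hv hvt
    rcases (hn.adj_iff v).1 hv with rfl | rfl | rfl
    · exact hp
    · exact hq
    · exact absurd rfl hvt
  refine ⟨?_, ?_, ?_⟩
  · intro u hu v huv
    by_cases hx : u = s ∧ v = t
    · obtain ⟨rfl, rfl⟩ := hx
      rwa [hst]
    · rw [hne u v (by tauto)]
      exact h.mem u hu v huv
  · intro u hu v w huv huw hvw
    by_cases hx : u = s ∧ v = t
    · obtain ⟨rfl, rfl⟩ := hx
      rw [hst, hne _ w (Or.inr hvw.symm)]
      exact hother w huw hvw.symm
    · rw [hne u v (by tauto)]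
      by_cases hy : u = s ∧ w = t
      · obtain ⟨rfl, rfl⟩ := hy
        rw [hst]
        exact (hother v huv hvw).symm
      · rw [hne u w (by tauto)]
        exact h.tail u hu v w huv huw hvw
  · intro u hu v hv w huv hvw
    rw [hne u v (Or.inr (hWt v hv))]
    by_cases hy : v = s ∧ w = t
    · obtain ⟨rfl, rfl⟩ := hy
      rw [hst]
      rcases (hn.adj_iff u).1 huv.symm with rfl | rfl | rfl
      · exact hp'.symm
      · exact hq'.symm
      · exact absurd hu ht
    · rw [hne v w (by tauto)]
      exact h.head u hu v hv w huv hvw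

end IsDartColoringOn

variable [Fintype V] [DecidableRel G.Adj] [DecidableEq α]

theorem IsRegularOfDegree.exists_isNeighborTriple (hG : G.IsRegularOfDegree 3) {s a : V}
    (h : G.Adj s a) : ∃ b d, G.IsNeighborTriple s a b d := by
  have h3 : #(G.neighborFinset s) = 3 := by rw [card_neighborFinset_eq_degree, hG s]
  have h2 : #((G.neighborFinset s).erase a) = 2 := by
    rw [card_erase_of_mem (by simpa using h), h3]
  obtain ⟨b, d, hbd, he⟩ := card_eq_two.1 h2
  have hz : ∀ z, (z ≠ a ∧ G.Adj s z) ↔ z = b ∨ z = d := fun z => by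
    have := congrArg (z ∈ ·) he
    simpa using this
  refine ⟨b, d, fun z => ?_, ((hz b).2 (by simp)).1.symm, ((hz d).2 (by simp)).1.symm, hbd⟩
  rw [← hz]
  by_cases hza : z = a
  · simp [hza, h]
  · simp [hza]

namespace IsDartColoringOn

/-- The darts that leave a vertex with an uncolored neighbor can be colored greedily. -/
theorem exists_insert (hG : G.IsRegularOfDegree 3) (hL : ∀ u v, G.Adj u v → #(L u v) = 6)
    (h : G.IsDartColoringOn L W c) {s t : V} (hs : s ∉ W) (ht : t ∉ W) (hst : G.Adj s t) :
    ∃ c', G.IsDartColoringOn L (insert s W) c' ∧ ∀ u, u ≠ s → c' u = c u := by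
  obtain ⟨p, q, hn⟩ := hG.exists_isNeighborTriple hst
  have hc := hG.card_outColors_le c
  -- `outColors c p` already contains `c p s`. If `p` or `q` is uncolored, its arbitrary values of
  -- `c` are avoided too, which the counts allow.
  have c1 : 2 ≤ #(L s p \ (insert (c q s) (G.outColors c p))) :=
    le_card_sdiff_of_card_le (m := 4) ((card_insert_le _ _).trans (by have := hc p; omega))
      (by rw [hL _ _ hn.adj₂])
  have c2 : 2 ≤ #(L s q \ (insert (c p s) (G.outColors c q))) :=
    le_card_sdiff_of_card_le (m := 4) ((card_insert_le _ _).trans (by have := hc q; omega))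
      (by rw [hL _ _ hn.adj₃])
  have c3 : 3 ≤ #(L s t \ {c p s, c q s}) :=
    le_card_sdiff_of_card_le (m := 2) card_le_two (by rw [hL _ _ hst]; omega)
  obtain ⟨e₁, h₁, e₂, h₂, e₃, h₃, h₁₂, h₁₃, h₂₃⟩ := exists_distinct_of_card (one_le_two.trans c1) c2 c3
  rw [mem_sdiff, mem_insert, not_or] at h₁ h₂
  rw [mem_sdiff, mem_insert, mem_singleton, not_or] at h₃
  have hps : c p s ∈ G.outColors c p := mem_outColors hn.adj₂.symm
  have hqs : c q s ∈ G.outColors c q := mem_outColors hn.adj₃.symm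
  obtain ⟨c', hc', hc'', -⟩ := h.extend hs hn.rotate h₁.1 h₂.1 h₃.1 h₁₂ h₁₃ h₂₃
    (by
      intro z hz hsz
      rcases (hn.adj_iff z).1 hsz with rfl | rfl | rfl
      · exact absurd hz ht
      · exact ⟨fun h => h₁.2.2 (h ▸ hps), Ne.symm h₂.2.1, Ne.symm h₃.2.1⟩
      · exact ⟨Ne.symm h₁.2.1, fun h => h₂.2.2 (h ▸ hqs), Ne.symm h₃.2.2⟩)
    (fun _ z hz h => h₁.2.2 (h ▸ mem_outColors hz))
    (fun _ z hz h => h₂.2.2 (h ▸ mem_outColors hz))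
    (fun hW => absurd hW ht)
  exact ⟨c', hc', hc''⟩

/-- Color greedily all darts that leave `U \ Z`, if every part of `U \ Z` has a neighbor
elsewhere in `U`. -/
theorem exists_extension (hG : G.IsRegularOfDegree 3) (hL : ∀ u v, G.Adj u v → #(L u v) = 6)
    {U Z : Finset V} (hZU : Z ⊆ U)
    (hUZ : ∀ K ⊆ U \ Z, K.Nonempty → ∃ s ∈ K, ∃ t ∈ U \ K, G.Adj s t)
    (h : G.IsDartColoringOn L Uᶜ c) :
    ∃ c', G.IsDartColoringOn L Zᶜ c' ∧ ∀ u ∉ U, c' u = c u := by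
  induction hn : #(U \ Z) generalizing Z with
  | zero =>
    rw [card_eq_zero, sdiff_eq_empty_iff_subset] at hn
    obtain rfl := subset_antisymm hZU hn
    exact ⟨c, h, fun _ _ => rfl⟩
  | succ n ih =>
    -- This `s`, adjacent to `Z`, is colored last: induction first treats `U \ insert s Z`, and `t ∈
    -- Z` is still uncolored afterwards.
    obtain ⟨s, hs, t, ht, hst⟩ := hUZ (U \ Z) subset_rfl (card_pos.1 (by omega))
    rw [mem_sdiff] at hs
    have htZ : t ∈ Z := by
      simp only [mem_sdiff] at ht
      tauto
    have hsub : U \ insert s Z ⊆ U \ Z := sdiff_subset_sdiff subset_rfl (subset_insert _ _)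
    obtain ⟨c₁, h₁, hc₁⟩ := ih (Z := insert s Z) (insert_subset hs.1 hZU)
      (fun K hK => hUZ K (hK.trans hsub))
      (by
        rw [sdiff_insert, card_erase_of_mem (mem_sdiff.2 hs), hn]
        rfl)
    obtain ⟨c₂, h₂, hc₂⟩ := h₁.exists_insert hG hL (s := s) (t := t) (by simp) (by simp [htZ]) hst
    refine ⟨c₂, ?_, fun u hu => ?_⟩
    · convert h₂ using 1
      ext z
      simp only [mem_compl, mem_insert]
      by_cases hz : z = s
      · simp [hz, hs.2]
      · simp [hz]
    · rw [hc₂ u (fun hus => hu (hus ▸ hs.1)), hc₁ u hu]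

/-- Complete a coloring of all darts but those that leave `t`. -/
theorem exists_completion (hG : G.IsRegularOfDegree 3) (hL : ∀ u v, G.Adj u v → #(L u v) = 6)
    {t x y v u r : V} (hc : G.IsDartColoringOn L {t}ᶜ c) (ht : G.IsNeighborTriple t x y v)
    (hx : G.IsNeighborTriple x t u r)
    (h4 : 4 ≤ #((L t v \ G.outColors c v) ∪ (L t x \ {c v t, c x u, c x r})))
    (h : 3 ≤ #(L x t \ {c x u, c x r, c u x, c r x}) ∨
      5 ≤ #((L t v \ G.outColors c v) ∪ (L t x \ {c v t, c x u, c x r}))) :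
    ∃ c', G.IsDartColoringOn L univ c' := by
  obtain ⟨p, q, hy⟩ := hG.exists_isNeighborTriple ht.adj₂.symm
  -- The colors `a`, `b`, `f₁`, `f₂`, `f₃` are for `yt`, `xt`, `tv`, `tx`, `ty`; only `yt` and `xt`
  -- do not conflict.
  obtain ⟨a, ha, b, hb, f₁, hf₁, f₂, hf₂, f₃, hf₃, ⟨n₁₂, n₁₃, n₂₃⟩, ⟨ha₁, ha₂, ha₃⟩,
      ⟨hb₁, hb₂, hb₃⟩⟩ :=
    exists_coloring_completeGraph_five_minus_edge
      (A := L y t \ {c y p, c y q, c p y, c q y})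
      (B := L x t \ {c x u, c x r, c u x, c r x})
      (F₁ := L t v \ G.outColors c v) (F₂ := L t x \ {c v t, c x u, c x r})
      (F₃ := L t y \ {c v t, c y p, c y q})
      (le_card_sdiff_of_card_le card_le_four (by rw [hL _ _ ht.adj₂.symm]))
      (le_card_sdiff_of_card_le card_le_four (by rw [hL _ _ ht.adj₁.symm]))
      (le_card_sdiff_of_card_le (hG.card_outColors_le c v) (by rw [hL _ _ ht.adj₃]))
      (le_card_sdiff_of_card_le card_le_three (by rw [hL _ _ ht.adj₁]))
      (le_card_sdiff_of_card_le card_le_three (by rw [hL _ _ ht.adj₂])) h4 h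
  simp only [mem_sdiff, mem_insert, mem_singleton, not_or] at ha hb hf₁ hf₂ hf₃
  obtain ⟨hx₁, hx₂, hx₃, hx₄, hx₅⟩ := hb
  obtain ⟨hy₁, hy₂, hy₃, hy₄, hy₅⟩ := ha
  have htx := ht.adj₁.ne
  have hty := ht.adj₂.ne
  have htv := ht.adj₃.ne
  have hxy := ht.ne₁₂
  have hxv := ht.ne₁₃
  have hyv := ht.ne₂₃
  have k₁ := hc.recolor (by simp) hx.rotate hx₁ hx₂ hx₃ hx₄ hx₅
  set c₁ := Function.update c x (Function.update (c x) t b) with hc₁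
  have c₁ne : ∀ z z', (z ≠ x ∨ z' ≠ t) → c₁ z z' = c z z' := by
    intro z z' hz
    by_cases hzx : z = x
    · subst hzx
      rw [hc₁, Function.update_self, Function.update_of_ne (by tauto)]
    · rw [hc₁, Function.update_of_ne hzx]
  have c₁xt : c₁ x t = b := by simp [hc₁]
  have k₂ := k₁.recolor (by simp) hy.rotate hy₁
    (by rwa [c₁ne _ _ (Or.inl hxy.symm)]) (by rwa [c₁ne _ _ (Or.inl hxy.symm)])
    (by rwa [c₁ne _ _ (Or.inr hty.symm)]) (by rwa [c₁ne _ _ (Or.inr hty.symm)])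
  set c₂ := Function.update c₁ y (Function.update (c₁ y) t a) with hc₂
  have c₂y : c₂ y = Function.update (c₁ y) t a := by simp [hc₂]
  have c₂x : c₂ x = c₁ x := by rw [hc₂, Function.update_of_ne hxy]
  have c₂v : c₂ v = c v := by
    rw [hc₂, Function.update_of_ne hyv.symm, hc₁, Function.update_of_ne hxv.symm]
  have c₂yt : c₂ y t = a := by simp [c₂y]
  have hvt : c v t ∈ G.outColors c v := mem_outColors ht.adj₃.symm
  obtain ⟨c₃, k₃, -⟩ := k₂.extend (s := t) (by simp) ht.rotate.rotate hf₁.1 hf₂.1 hf₃.1 n₁₂ n₁₃ n₂₃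
    (by
      intro z _ htz
      rcases (ht.adj_iff z).1 htz with rfl | rfl | rfl
      · rw [c₂x, c₁xt]
        exact ⟨hb₁, hb₂, hb₃⟩
      · rw [c₂yt]
        exact ⟨ha₁, ha₂, ha₃⟩
      · rw [c₂v]
        exact ⟨fun h => hf₁.2 (h ▸ hvt), Ne.symm hf₂.2.1, Ne.symm hf₃.2.1⟩)
    (by
      intro _ z hz h
      rw [c₂v] at h
      exact hf₁.2 (h ▸ mem_outColors hz))
    (by
      intro _ z hz
      rw [c₂x]
      rcases (hx.adj_iff z).1 hz with rfl | rfl | rfl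
      · rw [c₁xt]
        exact hb₂.symm
      · rw [c₁ne _ _ (Or.inr hx.ne₁₂.symm)]
        exact hf₂.2.2.1
      · rw [c₁ne _ _ (Or.inr hx.ne₁₃.symm)]
        exact hf₂.2.2.2)
    (by
      intro _ z hz
      rcases (hy.adj_iff z).1 hz with rfl | rfl | rfl
      · rw [c₂yt]
        exact ha₃.symm
      · rw [c₂y, Function.update_of_ne hy.ne₁₂.symm, c₁ne _ _ (Or.inl hxy.symm)]
        exact hf₃.2.2.1
      · rw [c₂y, Function.update_of_ne hy.ne₁₃.symm, c₁ne _ _ (Or.inl hxy.symm)]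
        exact hf₃.2.2.2)
  refine ⟨c₃, ?_⟩
  convert k₃ using 1
  ext z
  by_cases hz : z = t <;> simp [hz]

end IsDartColoringOn

end DartColoring

/-! ### Coloring the darts that leave the induced cycle -/

section InducedCycleColoring

variable {V : Type u} {α : Type w} {G : SimpleGraph V} [DecidableEq V] [Fintype V]
  [DecidableRel G.Adj] {S : Finset V}

namespace IsInducedCycle

theorem exists_isNeighborTriple (hS : G.IsInducedCycle S) (hG : G.IsRegularOfDegree 3) {s a : V}
    (hs : s ∈ S) (ha : a ∈ S) (h : G.Adj s a) :
    ∃ b ∈ S, ∃ d ∉ S, G.IsNeighborTriple s a b d := by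
  obtain ⟨b, d, hn⟩ := hG.exists_isNeighborTriple h
  have h2 := hS.card_inter s hs
  have hN : G.neighborFinset s = {a, b, d} := by
    ext z
    simp [hn.adj_iff]
  rw [hN, insert_inter_of_mem ha] at h2
  by_cases hb : b ∈ S <;> by_cases hd : d ∈ S
  · simp [insert_inter_of_mem, hb, hd, hn.ne₁₂, hn.ne₁₃, hn.ne₂₃] at h2
  · exact ⟨b, hb, d, hd, hn⟩
  · exact ⟨d, hd, b, hb, hn.swap.rotate⟩
  · simp [insert_inter_of_notMem, hb, hd] at h2

theorem not_forall_cut_eq (hS : G.IsInducedCycle S) {K : Finset V} (hK : K ⊆ S)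
    (hne : K.Nonempty) {t : V} (ht : t ∈ S) (htK : t ∉ K) (m w : V) :
    ¬ ∀ k ∈ K, ∀ z ∈ S, z ∉ K → G.Adj k z → k = m ∧ z = w := by
  intro h
  have h2 := hS.two_le_cut K hK hne (fun h => htK (h ▸ ht))
  have h1 : ∀ k ∈ K, #(G.neighborFinset k ∩ (S \ K)) ≤ if k = m then 1 else 0 := by
    intro k hk
    split_ifs with hkm
    · refine (card_le_card fun z hz => ?_).trans (card_singleton w).le
      simp only [mem_inter, mem_neighborFinset, mem_sdiff] at hz
      simpa using (h k hk z hz.2.1 hz.2.2 hz.1).2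
    · rw [Nat.le_zero, card_eq_zero, eq_empty_iff_forall_notMem]
      intro z hz
      simp only [mem_inter, mem_neighborFinset, mem_sdiff] at hz
      exact hkm (h k hk z hz.2.1 hz.2.2 hz.1).1
  have h3 := sum_le_sum h1
  rw [← card_filter] at h3
  have h4 : #{k ∈ K | k = m} ≤ 1 := by
    rw [filter_eq']
    split_ifs <;> simp
  omega

/-- Otherwise `ux` would be the only edge of the cycle leaving `K`. This lets `exists_extension`
color the path `S - x` towards `t`. -/
theorem exists_adj_of_subset_erase (hS : G.IsInducedCycle S) {t x u r : V} (ht : t ∈ S) (hr : r ∉ S)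
    (hx : G.IsNeighborTriple x t u r) {K : Finset V} (hK : K ⊆ S.erase x \ {t})
    (hne : K.Nonempty) : ∃ s ∈ K, ∃ z ∈ S.erase x \ K, G.Adj s z := by
  by_contra! hcon
  have hK' : ∀ k ∈ K, k ≠ x ∧ k ∈ S ∧ k ≠ t := fun k hk => by simpa [and_assoc] using hK hk
  refine hS.not_forall_cut_eq (fun k hk => (hK' k hk).2.1) hne ht
    (fun h => (hK' t h).2.2 rfl) u x fun k hk z hz hzK hkz => ?_
  obtain rfl : z = x := by
    by_contra hzx
    exact hcon k hk z (by simp [hzx, hz, hzK]) hkz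
  refine ⟨?_, rfl⟩
  rcases (hx.adj_iff k).1 hkz.symm with rfl | rfl | rfl
  · exact absurd rfl (hK' _ hk).2.2
  · rfl
  · exact absurd (hK' _ hk).2.1 hr

/-- Here `K` misses both cycle neighbors of `x`, so only the edge `zu` could leave it. -/
theorem exists_adj_of_subset_erase_erase (hS : G.IsInducedCycle S) {t x u r z r' : V} (ht : t ∈ S)
    (hr : r ∉ S) (hr' : r' ∉ S) (hx : G.IsNeighborTriple x t u r)
    (hu : G.IsNeighborTriple u x z r') {K : Finset V}
    (hK : K ⊆ (S.erase x).erase u \ {t}) (hne : K.Nonempty) :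
    ∃ s ∈ K, ∃ z ∈ (S.erase x).erase u \ K, G.Adj s z := by
  by_contra! hcon
  have hK' : ∀ k ∈ K, k ≠ u ∧ k ≠ x ∧ k ∈ S ∧ k ≠ t := fun k hk => by
    simpa [and_assoc] using hK hk
  refine hS.not_forall_cut_eq (fun k hk => (hK' k hk).2.2.1) hne ht
    (fun h => (hK' t h).2.2.2 rfl) z u fun k hk y hy hyK hky => ?_
  obtain ⟨k₁, k₂, k₃, k₄⟩ := hK' k hk
  have hyx : y ≠ x := by
    rintro rfl
    rcases (hx.adj_iff k).1 hky.symm with rfl | rfl | rfl <;> contradiction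
  obtain rfl : y = u := by
    by_contra hyu
    exact hcon k hk y (by simp [hyx, hyu, hy, hyK]) hky
  refine ⟨?_, rfl⟩
  rcases (hu.adj_iff k).1 hky.symm with rfl | rfl | rfl
  · contradiction
  · rfl
  · contradiction

variable [DecidableEq α] {L : V → V → Finset α} {c : V → V → α}

/-- Extend a coloring of the darts that leave the complement of an induced cycle, with prescribed
colors `a` and `m` for two darts that leave the vertex `x` of the cycle. -/
theorem exists_coloring_of_choice (hS : G.IsInducedCycle S) (hG : G.IsRegularOfDegree 3)
    (hL : ∀ u v, G.Adj u v → #(L u v) = 6) (hc : G.IsDartColoringOn L Sᶜ c)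
    {t x u r y v : V} (htS : t ∈ S) (hxS : x ∈ S) (huS : u ∈ S) (hrS : r ∉ S)
    (hvS : v ∉ S) (hx : G.IsNeighborTriple x t u r) (ht : G.IsNeighborTriple t x y v) {a m : α}
    (ha : a ∈ L x u \ {c r x}) (hm : m ∈ L x r \ G.outColors c r) (ham : a ≠ m)
    (h4 : 4 ≤ #((L t v \ G.outColors c v) ∪ ((L t x \ {c v t}) \ {a, m})))
    (h : (∃ P ⊆ L x t \ {c r x}, 5 ≤ #P ∧ m ∉ P) ∨
      5 ≤ #((L t v \ G.outColors c v) ∪ ((L t x \ {c v t}) \ {a, m}))) :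
    ∃ c', G.IsDartColoringOn L univ c' := by
  -- A provisional color for `xt`, replaced in `exists_completion`.
  obtain ⟨e, he⟩ : (L x t \ {c r x, a, m}).Nonempty := card_pos.1
    (le_card_sdiff_of_card_le (m := 3) card_le_three (by rw [hL _ _ hx.adj₁]; omega))
  simp only [mem_sdiff, mem_insert, mem_singleton, not_or] at he ha hm
  obtain ⟨he, her, hea, hem⟩ := he
  have hrx : c r x ∈ G.outColors c r := mem_outColors hx.adj₃.symm
  obtain ⟨c₁, k₁, hc₁, -, hca, hcm⟩ := hc.extend (s := x) (by simpa using hxS) hx he ha.1 hm.1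
    hea hem ham
    (by
      intro z hz hxz
      rcases (hx.adj_iff z).1 hxz with rfl | rfl | rfl
      · simp [htS] at hz
      · simp [huS] at hz
      · exact ⟨Ne.symm her, Ne.symm ha.2, fun h => hm.2 (h ▸ hrx)⟩)
    (by simp [htS]) (by simp [huS])
    (fun _ z hz h => hm.2 (h ▸ mem_outColors hz))
  obtain ⟨c₂, k₂, hc₂⟩ := IsDartColoringOn.exists_extension hG hL (U := S.erase x) (Z := {t}) (c := c₁)
    (by simpa [htS] using hx.adj₁.ne')
    (fun K hK hne => hS.exists_adj_of_subset_erase htS hrS hx hK hne)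
    (by rwa [compl_erase])
  have hx₂ : c₂ x = c₁ x := hc₂ x (by simp)
  have hout : ∀ z ∉ S, c₂ z = c z := fun z hz => by
    rw [hc₂ z (by simp [hz]), hc₁ z (by rintro rfl; exact hz hxS)]
  have hF : L t x \ {c₂ v t, c₂ x u, c₂ x r} = (L t x \ {c v t}) \ {a, m} := by
    rw [hx₂, hca, hcm, hout v hvS]
    ext z
    simp
    tauto
  have hO : G.outColors c₂ v = G.outColors c v := by rw [outColors, outColors, hout v hvS]
  refine k₂.exists_completion hG hL ht hx (by rwa [hF, hO]) ?_
  rw [hF, hO]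
  refine h.imp_left fun ⟨P, hP, hP5, hmP⟩ => ?_
  -- Since `m ∉ P`, only `a` and the color of `ux` are lost from `P`, so three colors remain for
  -- `xt`.
  have hsub : P \ {a, c₂ u x} ⊆ L x t \ {c₂ x u, c₂ x r, c₂ u x, c₂ r x} := by
    intro z hz
    rw [hx₂, hca, hcm, hout r hrS]
    rw [mem_sdiff] at hz
    have hzP := hP hz.1
    have hzm : z ≠ m := fun h => hmP (h ▸ hz.1)
    simp only [mem_sdiff, mem_insert, mem_singleton, not_or] at hz hzP ⊢
    tauto
  exact (le_card_sdiff_of_card_le card_le_two hP5).trans (card_le_card hsub)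

/-- Extend a coloring of the darts that leave the complement of an induced cycle, if a dart that
enters the vertex `x` of the cycle can get a color `b` that is useless for another dart leaving
`x`. -/
theorem exists_coloring_of_entering (hS : G.IsInducedCycle S) (hG : G.IsRegularOfDegree 3)
    (hL : ∀ u v, G.Adj u v → #(L u v) = 6) (hc : G.IsDartColoringOn L Sᶜ c)
    {t x u r y v z r' : V} (htS : t ∈ S) (hxS : x ∈ S) (huS : u ∈ S) (hrS : r ∉ S)
    (hvS : v ∉ S) (hzS : z ∈ S) (hrS' : r' ∉ S) (hx : G.IsNeighborTriple x t u r)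
    (ht : G.IsNeighborTriple t x y v) (hu : G.IsNeighborTriple u x z r') {b : α} {P : Finset α}
    (hb : b ∈ L u x \ {c r' u}) (hP : P ⊆ L x t \ {c r x}) (hP5 : 5 ≤ #P) (hbP : b ∉ P) :
    ∃ c', G.IsDartColoringOn L univ c' := by
  have hO := hG.card_outColors_le c
  obtain ⟨m, hm, hmb⟩ := Finset.exists_mem_notMem_of_card_lt_card (s := {b})
    (t := L x r \ G.outColors c r) (lt_of_lt_of_le (by rw [card_singleton]; omega)
      (le_card_sdiff_of_card_le (n := 3) (hO r) (by rw [hL _ _ hx.adj₃])))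
  obtain ⟨a, ha, h4⟩ := exists_four_le_card_union (R := L x u \ {c r x, b, m}) (m := m)
    (X := L t x \ {c v t}) (F := L t v \ G.outColors c v)
    (le_card_sdiff_of_card_le card_le_three (by rw [hL _ _ hx.adj₂]; omega))
    (le_card_sdiff_of_card_le (card_singleton _).le (by rw [hL _ _ ht.adj₁]))
    (le_card_sdiff_of_card_le (hO v) (by rw [hL _ _ ht.adj₃]))
  -- Taking the provisional color of `xt` from `P` keeps it different from `b`, the color of `ux`.
  obtain ⟨e, he⟩ : (P \ {a, m}).Nonempty := card_pos.1
    (lt_of_lt_of_le (by omega) (le_card_sdiff_of_card_le (n := 3) card_le_two hP5))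
  obtain ⟨m', hm'⟩ : ((L u r' \ G.outColors c r') \ {a, b}).Nonempty := card_pos.1
    (le_card_sdiff_of_card_le (m := 2) card_le_two
      (le_card_sdiff_of_card_le (m := 3) (hO r') (by rw [hL _ _ hu.adj₃])))
  obtain ⟨a', ha'⟩ : (L u z \ {c r' u, a, b, m'}).Nonempty := card_pos.1
    (le_card_sdiff_of_card_le (m := 4) card_le_four (by rw [hL _ _ hu.adj₂]; omega))
  have heP : e ∈ P := (mem_sdiff.1 he).1
  have hePL := hP heP
  have heb : b ≠ e := fun h => hbP (h ▸ heP)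
  simp only [mem_sdiff, mem_insert, mem_singleton, not_or] at *
  obtain ⟨ha, har, hab, ham⟩ := ha
  obtain ⟨ha', har', haa', hab', ham'⟩ := ha'
  have hrx : c r x ∈ G.outColors c r := mem_outColors hx.adj₃.symm
  have hru : c r' u ∈ G.outColors c r' := mem_outColors hu.adj₃.symm
  have hxu := hx.adj₂.ne
  obtain ⟨c₁, k₁, hc₁, hce, hca, hcm⟩ := hc.extend (s := x) (by simpa using hxS) hx hePL.1 ha hm.1
    he.2.1 he.2.2 ham
    (by
      intro w hw hxw
      rcases (hx.adj_iff w).1 hxw with rfl | rfl | rfl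
      · simp [htS] at hw
      · simp [huS] at hw
      · exact ⟨Ne.symm hePL.2, Ne.symm har, fun h => hm.2 (h ▸ hrx)⟩)
    (by simp [htS]) (by simp [huS])
    (fun _ w hw h => hm.2 (h ▸ mem_outColors hw))
  have hr'x : r' ≠ x := fun h => hrS' (h ▸ hxS)
  obtain ⟨c₂, k₂, hc₂, hcb, -, -⟩ := k₁.extend (s := u)
    (by simpa [huS] using hxu.symm) hu hb.1 ha' hm'.1.1
    (Ne.symm hab') (Ne.symm hm'.2.2) ham'
    (by
      intro w hw huw
      rcases (hu.adj_iff w).1 huw with rfl | rfl | rfl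
      · rw [hca]
        exact ⟨hab, Ne.symm haa', Ne.symm hm'.2.1⟩
      · simp [hzS, hu.ne₁₂.symm] at hw
      · rw [hc₁ _ hr'x]
        exact ⟨Ne.symm hb.2, Ne.symm har', fun h => hm'.1.2 (h ▸ hru)⟩)
    (by
      intro _ w hw
      rcases (hx.adj_iff w).1 hw with rfl | rfl | rfl
      · rwa [hce]
      · rw [hca]
        exact Ne.symm hab
      · rw [hcm]
        exact Ne.symm hmb)
    (by simp [hzS, hu.ne₁₂.symm])
    (by
      intro _ w hw h
      rw [hc₁ _ hr'x] at h
      exact hm'.1.2 (h ▸ mem_outColors hw))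
  obtain ⟨c₃, k₃, hc₃⟩ := IsDartColoringOn.exists_extension hG hL
    (U := (S.erase x).erase u) (Z := {t}) (c := c₂)
    (by simpa [htS] using ⟨hx.ne₁₂, hx.adj₁.ne'⟩)
    (fun K hK hne => hS.exists_adj_of_subset_erase_erase htS hrS hrS' hx hu hK hne)
    (by rwa [compl_erase, compl_erase])
  have hx₃ : c₃ x = c₁ x := by rw [hc₃ x (by simp), hc₂ x hxu]
  have hu₃ : c₃ u x = b := by rw [hc₃ u (by simp), hcb]
  have hout : ∀ w ∉ S, c₃ w = c w := fun w hw => by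
    rw [hc₃ w (by simp [hw]), hc₂ w (by rintro rfl; exact hw huS),
      hc₁ w (by rintro rfl; exact hw hxS)]
  have hF : L t x \ {c₃ v t, c₃ x u, c₃ x r} = (L t x \ {c v t}) \ {a, m} := by
    rw [hx₃, hca, hcm, hout v hvS]
    ext w
    simp
    tauto
  have hO : G.outColors c₃ v = G.outColors c v := by rw [outColors, outColors, hout v hvS]
  refine k₃.exists_completion hG hL ht hx (by rwa [hF, hO]) (Or.inl ?_)
  have hsub : P \ {a, m} ⊆ L x t \ {c₃ x u, c₃ x r, c₃ u x, c₃ r x} := by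
    intro w hw
    rw [hx₃, hca, hcm, hu₃, hout r hrS]
    rw [mem_sdiff] at hw
    have hwP := hP hw.1
    have hwb : w ≠ b := fun h => hbP (h ▸ hw.1)
    simp only [mem_sdiff, mem_insert, mem_singleton, not_or] at hw hwP ⊢
    tauto
  exact (le_card_sdiff_of_card_le card_le_two hP5).trans (card_le_card hsub)

/-- Giving `xr` a color `m ∉ P` costs `xt` nothing from `P`. -/
theorem exists_coloring_of_not_subset (hS : G.IsInducedCycle S) (hG : G.IsRegularOfDegree 3)
    (hL : ∀ u v, G.Adj u v → #(L u v) = 6) (hc : G.IsDartColoringOn L Sᶜ c)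
    {t x u r y v : V} (htS : t ∈ S) (hxS : x ∈ S) (huS : u ∈ S) (hrS : r ∉ S)
    (hvS : v ∉ S) (hx : G.IsNeighborTriple x t u r) (ht : G.IsNeighborTriple t x y v)
    {P : Finset α} (hP : P ⊆ L x t \ {c r x}) (hP5 : 5 ≤ #P)
    (h : ¬ L x r \ G.outColors c r ⊆ P) :
    ∃ c', G.IsDartColoringOn L univ c' := by
  obtain ⟨m, hm, hmP⟩ := not_subset.1 h
  obtain ⟨a, ha, h4⟩ := exists_four_le_card_union (R := L x u \ {c r x, m}) (m := m)
    (X := L t x \ {c v t}) (F := L t v \ G.outColors c v)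
    (le_card_sdiff_of_card_le card_le_two (by rw [hL _ _ hx.adj₂]; omega))
    (le_card_sdiff_of_card_le (card_singleton _).le (by rw [hL _ _ ht.adj₁]))
    (le_card_sdiff_of_card_le (hG.card_outColors_le c v) (by rw [hL _ _ ht.adj₃]))
  simp only [mem_sdiff, mem_insert, mem_singleton, not_or] at ha
  exact hS.exists_coloring_of_choice hG hL hc htS hxS huS hrS hvS hx ht
    (by simp [ha]) hm ha.2.2 h4 (Or.inl ⟨P, hP, hP5, hmP⟩)

theorem exists_coloring (hS : G.IsInducedCycle S) (hG : G.IsRegularOfDegree 3)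
    (hL : ∀ u v, G.Adj u v → #(L u v) = 6) (hc : G.IsDartColoringOn L Sᶜ c) :
    ∃ c', G.IsDartColoringOn L univ c' := by
  have hO := hG.card_outColors_le c
  obtain ⟨x, hxS⟩ := hS.nonempty
  obtain ⟨t, ht⟩ := card_pos.1 (show 0 < #(G.neighborFinset x ∩ S) by
    rw [hS.card_inter x hxS]; omega)
  rw [mem_inter, mem_neighborFinset] at ht
  obtain ⟨hxt, htS⟩ := ht
  obtain ⟨u, huS, r, hrS, hx⟩ := hS.exists_isNeighborTriple hG hxS htS hxt
  obtain ⟨y, hyS, v, hvS, ht⟩ := hS.exists_isNeighborTriple hG htS hxS hxt.symm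
  obtain ⟨z, hzS, r', hrS', hu⟩ := hS.exists_isNeighborTriple hG huS hxS hx.adj₂.symm
  obtain ⟨R, hR, hR5⟩ := exists_subset_card_eq (s := L x u \ {c r x}) (n := 5)
    (le_card_sdiff_of_card_le (card_singleton _).le (by rw [hL _ _ hx.adj₂]))
  obtain ⟨Q, hQ, hQ5⟩ := exists_subset_card_eq (s := L t x \ {c v t}) (n := 5)
    (le_card_sdiff_of_card_le (card_singleton _).le (by rw [hL _ _ ht.adj₁]))
  -- Each failing inclusion yields a color useless to another dart. The first two cases finish at
  -- `u`, with `t` and `u` interchanged; the third finishes at `x`, with `t` and `x` interchanged.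
  by_cases h₁ : L x r \ G.outColors c r ⊆ R
  swap
  · exact hS.exists_coloring_of_not_subset hG hL hc huS hxS htS hrS hrS' hx.swap hu hR hR5.ge h₁
  by_cases h₂ : Q ⊆ R
  swap
  · obtain ⟨b, hbQ, hbR⟩ := not_subset.1 h₂
    exact hS.exists_coloring_of_entering hG hL hc huS hxS htS hrS hrS' hyS hvS hx.swap hu ht
      (hQ hbQ) hR hR5.ge hbR
  by_cases h₃ : L t v \ G.outColors c v ⊆ Q
  swap
  · exact hS.exists_coloring_of_not_subset hG hL hc hxS htS hyS hvS hrS ht hx hQ hQ5.ge h₃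
  have c₁ : 3 ≤ #(L x r \ G.outColors c r) :=
    le_card_sdiff_of_card_le (hO r) (by rw [hL _ _ hx.adj₃])
  have c₃ : 3 ≤ #(L t v \ G.outColors c v) :=
    le_card_sdiff_of_card_le (hO v) (by rw [hL _ _ ht.adj₃])
  -- Both sets have at least three elements and lie in the 5-set `R`.
  have hinter : ¬ Disjoint (L x r \ G.outColors c r) (L t v \ G.outColors c v) := by
    intro hd
    have := card_le_card (union_subset h₁ (h₃.trans h₂))
    rw [card_union_of_disjoint hd] at this
    omega
  obtain ⟨m, hm, hm'⟩ := not_disjoint_iff.1 hinter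
  obtain ⟨a, ha, ham⟩ := Finset.exists_mem_notMem_of_card_lt_card (s := {m})
    (t := L t v \ G.outColors c v) (by rw [card_singleton]; omega)
  rw [mem_singleton] at ham
  -- The colors `a`, `m` removed from the list of `tx` belong to that of `tv`, so the union still
  -- contains `Q`.
  have h5 : 5 ≤ #((L t v \ G.outColors c v) ∪ ((L t x \ {c v t}) \ {a, m})) := by
    rw [← hQ5]
    refine card_le_card fun w hw => ?_
    by_cases hw' : w = a ∨ w = m
    · rcases hw' with rfl | rfl
      · exact mem_union_left _ ha
      · exact mem_union_left _ hm'
    · exact mem_union_right _ (mem_sdiff.2 ⟨hQ hw, by simpa using hw'⟩)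
  exact hS.exists_coloring_of_choice hG hL hc htS hxS huS hrS hvS hx ht
    (hR (h₂ (h₃ ha))) hm ham (by omega) (Or.inr h5)

end IsInducedCycle

/-- A connected cubic graph has a dart coloring from any lists of six colors. -/
theorem IsRegularOfDegree.exists_isDartColoringOn_univ [DecidableEq α] (hG : G.IsRegularOfDegree 3)
    (hconn : G.Connected) {L : V → V → Finset α} (hL : ∀ u v, G.Adj u v → #(L u v) = 6) :
    ∃ c, G.IsDartColoringOn L univ c := by
  have := hconn.nonempty
  obtain ⟨S, hS⟩ := hG.exists_isInducedCycle
  obtain ⟨s, hs⟩ := hS.nonempty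
  obtain ⟨a, ha⟩ := card_pos.1 (show 0 < #(G.neighborFinset s ∩ S) by
    rw [hS.card_inter s hs]; omega)
  rw [mem_inter, mem_neighborFinset] at ha
  obtain ⟨e, -⟩ := card_pos.1 (show 0 < #(L s a) by rw [hL s a ha.1]; omega)
  -- Start from a constant function, vacuously a coloring on the empty set; a walk to `s` must leave
  -- `K`.
  obtain ⟨c, hc, -⟩ := IsDartColoringOn.exists_extension hG hL (U := univ) (Z := S)
    (c := fun _ _ => e) (subset_univ _)
    (by
      intro K hK ⟨k, hk⟩
      have hsK : s ∉ K := fun h => (mem_sdiff.1 (hK h)).2 hs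
      obtain ⟨p⟩ := hconn.preconnected k s
      obtain ⟨d, -, hd, hd'⟩ := p.exists_boundary_dart (K : Set V) hk hsK
      exact ⟨d.fst, hd, d.snd, by simpa using hd', d.adj⟩)
    ⟨by simp, by simp, by simp⟩
  exact hS.exists_coloring hG hL hc

end InducedCycleColoring

/-! ### From darts back to incidences -/

theorem IsRegularOfDegree.incidenceChoosable_six {V : Type u} [Fintype V] {G : SimpleGraph V}
    [DecidableRel G.Adj] (hG : G.IsRegularOfDegree 3) (hconn : G.Connected) :
    IncidenceChoosable.{u, w} G 6 := by
  classical
  intro α L hL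
  obtain ⟨c, hc⟩ := hG.exists_isDartColoringOn_univ hconn
    (L := fun u v => if h : G.Adj u v then L ⟨(u, s(u, v)), h, Sym2.mem_mk_left u v⟩ else ∅)
    (fun u v h => by simp [h, hL])
  have key : ∀ i : G.Incidence, ∃ v, G.Adj i.1.1 v ∧ i.1.2 = s(i.1.1, v) := by
    rintro ⟨⟨u, e⟩, he, hu⟩
    obtain ⟨v, hv⟩ := Sym2.mem_iff_exists.1 hu
    dsimp only at hv
    subst hv
    exact ⟨v, he, rfl⟩
  choose f hf hfe using key
  refine ⟨fun i => c i.1.1 (f i), ?_, ?_⟩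
  · rintro i j ⟨hij, h⟩
    have hi := hf i
    have hj := hf j
    have hei := hfe i
    have hej := hfe j
    change c i.1.1 (f i) ≠ c j.1.1 (f j)
    have hne : ¬ (i.1.1 = j.1.1 ∧ f i = f j) := by
      rintro ⟨h₁, h₂⟩
      exact hij (Subtype.ext (Prod.ext h₁ (by rw [hei, hej, h₁, h₂])))
    generalize f i = a at *
    generalize f j = b at *
    rw [hei, hej] at h
    generalize i.1.1 = u at *
    generalize j.1.1 = v at *
    -- The cases are: equal tails, the same edge (then opposite darts, which are consecutive), and
    -- consecutive darts in either order.
    rcases h with rfl | h | h | h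
    · exact hc.tail u (mem_univ _) a b hi hj (by tauto)
    · rcases Sym2.eq_iff.1 h with h | ⟨rfl, rfl⟩
      · exact absurd h hne
      · exact hc.head _ (mem_univ _) _ (mem_univ _) _ hi hj
    · obtain rfl := Sym2.congr_right.1 h
      exact hc.head _ (mem_univ _) _ (mem_univ _) _ hi hj
    · rw [Sym2.eq_swap] at h
      obtain rfl := Sym2.congr_right.1 h
      exact (hc.head _ (mem_univ _) _ (mem_univ _) _ hj hi).symm
  · intro i
    have h := hc.mem i.1.1 (mem_univ _) (f i) (hf i)
    rw [dif_pos (hf i)] at h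
    convert h using 2
    exact Subtype.ext (Prod.ext rfl (hfe i))

end SimpleGraph

theorem theorem2p1 {V : Type u} [Fintype V] (G : SimpleGraph V) [DecidableRel G.Adj]
    (hcubic : G.IsRegularOfDegree 3) (hconn : G.IsTwoConnected) :
    SimpleGraph.incidenceChoiceNumber.{u, w} G ≤ 6 :=
  iInf₂_le 6 (hcubic.incidenceChoosable_six hconn.2.1)
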